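/- Let $n \ge 1$, let $\lambda$ be a partition of $n$ with exactly $m_i$ parts equal to $i$ ($1 \le i \le n$), and let $\mathcal{C}_\lambda$ be the conjugacy class of $S_n$ consisting of the permutations with cycle type $\lambda$ (fixed points are counted as parts equal to $1$). For $\pi \in S_n$ let $d(\pi) = |\{\, i \in \{1,\dots,n-1\} : \pi(i) > \pi(i+1) \,\}|$ be its number of descents, and let $$A_{\mathcal{C}_\lambda}(t) = \sum_{\pi \in \mathcal{C}_\lambda} t^{\,d(\pi)+1}$$ be the descent generating function of $\mathcal{C}_\lambda$. For $i \ge 1$ and $a \in \mathbb{Z}$ put $f_{i,a} = \frac{1}{i} \sum_{d \mid i} \mu(d)\, a^{i/d}$, where $\mu$ is the Möbius function, and let $\binom{x}{m} = x(x-1)\cdots(x-m+1)/m!$. Then for every complex number $t$ with $|t| > 1$ the following series converges absolutely and $$A_{\mathcal{C}_\lambda}(t) = (t-1)^{n+1} \sum_{a=1}^{\infty} t^{-a} \left[ (-1)^n \prod_{i=1}^{n} \binom{f_{i,-a} + m_i - 1}{m_i} \right].$$ -/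

import Mathlib

open Equiv Finset

noncomputable section

/-- The descent set of `π ∈ Sₙ`: the positions `i` with a successor such that `π(i) > π(i+1)`
(positions are indexed by `0, …, n-1`, so a descent position is one of `0, …, n-2`). -/
def descentSet {n : ℕ} (π : Perm (Fin n)) : Finset (Fin n) :=
  {i : Fin n | ∃ h : (i : ℕ) + 1 < n, π ⟨(i : ℕ) + 1, h⟩ < π i}

/-- The descent number `d(π) = |Des(π)|`. -/
def descentNumber {n : ℕ} (π : Perm (Fin n)) : ℕ := (descentSet π).card

open Classical in
/-- The descent generating function of a set `S` of permutations, in the normalization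
`A_S(t) = ∑_{π ∈ S} t^{d(π)+1}` of the classical Eulerian polynomials
(for which `∑_{a ≥ 1} aⁿ tᵃ = A_{Sₙ}(t) / (1-t)^{n+1}`). -/
def descentGenFun {n : ℕ} (S : Set (Perm (Fin n))) (t : ℂ) : ℂ :=
  ∑ π : Perm (Fin n) with π ∈ S, t ^ (descentNumber π + 1)

/-- `f_{i,a} = (1/i) ∑_{d ∣ i} μ(d) a^{i/d}`, for `i ≥ 1` and any integer `a`. -/
def necklaceNumber (i : ℕ) (a : ℤ) : ℚ :=
  (1 / (i : ℚ)) * ∑ d ∈ i.divisors, (ArithmeticFunction.moebius d : ℚ) * (a : ℚ) ^ (i / d)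

/-- The product `∏_{i=1}^n binom(f_{i,a} + m_i - 1, m_i)`, where `m_i` is the number of parts
of `lam` equal to `i` and `binom(x, m) = x(x-1)⋯(x-m+1)/m!`. -/
def cycleBinomialProduct {n : ℕ} (lam : n.Partition) (a : ℤ) : ℚ :=
  ∏ i ∈ Finset.Icc 1 n,
    Ring.choose (necklaceNumber i a + (lam.parts.count i : ℚ) - 1) (lam.parts.count i)

end

/-! ### Orbits of a permutation and functions invariant under it -/

open Function (minimalPeriod IsPeriodicPt)

/-! The core is the Gessel–Reutenauer bijection. Call a permutation π with labels s in an alphabet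
of size a sorted if x ↦ (s x, π x) increases lexicographically, that is, s increases weakly, and
strictly at the descents of π. For fixed π there are binom(a + n - 1 - d(π), n) such labellings
(`card_strictMono_toLex`). Reading s along the π-orbits turns a sorted pair into a multiset of
primitive necklaces whose lengths are the cycle lengths of π. This is a bijection
(`card_sorted_eq_card_invariant`). There are f_{i,a} primitive necklaces of length i, so summing
over the class gives ∏ binom(f_{i,a} + m_i - 1, m_i) = ∑ binom(a + n - 1 - d(π), n) for every
natural a (`sum_choose_descentNumber`).

Both sides are polynomials in a, so the identity persists at -a, where the right side becomes (-1)^n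
∑ binom(a + d(π), n) (`cycleBinomialProduct_neg`). The theorem then follows termwise from ∑_{a ≥ 1}
binom(a + d, n) t^{-a} = t^{d+1} / (t-1)^{n+1} for d < n (`hasSum_choose_mul_zpow`). -/

theorem Equiv.Perm.IsCycleOn.minimalPeriod_eq_card {α : Type*} {σ : Perm α} {s : Finset α}
    (h : σ.IsCycleOn s) {x : α} (hx : x ∈ s) : minimalPeriod σ x = #s := by
  refine Nat.dvd_right_iff_eq.mp fun k => ?_
  rw [← Function.isPeriodicPt_iff_minimalPeriod_dvd, ← h.pow_apply_eq hx, IsPeriodicPt,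
    Function.IsFixedPt, Equiv.Perm.iterate_eq_pow]

theorem Equiv.Perm.minimalPeriod_pos {α : Type*} [Finite α] (σ : Perm α) (x : α) :
    0 < minimalPeriod σ x :=
  Function.minimalPeriod_pos_of_mem_periodicPts (σ.injective.mem_periodicPts x)

/-- Translates cycle type into numbers of points of each period, which can be compared with periods
of words. Fixed points need their own case since `cycleType` omits them. -/
theorem Equiv.Perm.card_minimalPeriod_eq {α : Type*} [Fintype α] [DecidableEq α] (σ : Perm α)
    (i : ℕ) : #{x | minimalPeriod σ x = i} = i * σ.partition.parts.count i := by
  rcases Nat.eq_zero_or_pos i with rfl | hi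
  · simp [(σ.minimalPeriod_pos _).ne']
  rw [Perm.parts_partition, Multiset.count_add, Multiset.count_replicate]
  rcases (show 1 ≤ i from hi).eq_or_lt with rfl | hi
  · have h0 : σ.cycleType.count 1 = 0 := by
      rw [Multiset.count_eq_zero]
      exact fun h => absurd (Perm.two_le_of_mem_cycleType h) (by norm_num)
    rw [h0, if_pos rfl, zero_add, one_mul, ← card_compl]
    congr 1
    ext x
    simp [Function.minimalPeriod_eq_one_iff_isFixedPt, Function.IsFixedPt]
  rw [if_neg (by omega), add_zero, Perm.cycleType_def, Multiset.count_map]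
  have key : ({x | minimalPeriod σ x = i} : Finset α) =
      (σ.cycleFactorsFinset.filter fun c => i = #c.support).biUnion Perm.support := by
    ext x
    simp only [mem_filter, mem_univ, true_and, mem_biUnion]
    constructor
    · intro hx
      have hxs : x ∈ σ.support := by
        rw [Perm.mem_support]
        intro h
        have := Function.minimalPeriod_eq_one_iff_isFixedPt.2 h
        omega
      have hc := Perm.cycleOf_mem_cycleFactorsFinset_iff.2 hxs
      have hxc : x ∈ (σ.cycleOf x).support := by
        rw [Perm.mem_support_cycleOf_iff' (Perm.mem_support.1 hxs)]
      exact ⟨σ.cycleOf x, ⟨hc, by rw [← hx]; exact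
        (Perm.isCycleOn_support_of_mem_cycleFactorsFinset hc).minimalPeriod_eq_card hxc⟩, hxc⟩
    · rintro ⟨c, ⟨hc, rfl⟩, hx⟩
      exact (Perm.isCycleOn_support_of_mem_cycleFactorsFinset hc).minimalPeriod_eq_card hx
  rw [key, card_biUnion]
  · rw [sum_congr rfl (g := fun _ => i) (fun c hc => (mem_filter.1 hc).2.symm), sum_const,
      smul_eq_mul, mul_comm]
    rfl
  · intro c hc d hd hcd
    exact Perm.disjoint_iff_disjoint_support.1 (Perm.cycleFactorsFinset_pairwise_disjoint σ
      (mem_filter.1 hc).1 (mem_filter.1 hd).1 hcd)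

/-- The orbits of a permutation. -/
abbrev Equiv.Perm.Orbits {α : Type*} (σ : Perm α) : Type _ := Quotient (Perm.SameCycle.setoid σ)

theorem Equiv.Perm.isCycleOn_orbit {α : Type*} (σ : Perm α) (x : α) :
    σ.IsCycleOn {y | σ.SameCycle x y} :=
  ⟨⟨fun _ hy => Perm.sameCycle_apply_right.2 hy, σ.injective.injOn, fun y hy =>
    ⟨σ⁻¹ y, Perm.sameCycle_apply_right.1 (by simpa using hy), by simp⟩⟩, fun _ hy _ hz => hy.symm.trans hz⟩

open Classical in
theorem Equiv.Perm.minimalPeriod_eq_card_sameCycle {α : Type*} [Fintype α] (σ : Perm α)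
    (x y : α) (h : σ.SameCycle x y) : minimalPeriod σ y = #{z | σ.SameCycle x z} := by
  have := σ.isCycleOn_orbit x
  refine Perm.IsCycleOn.minimalPeriod_eq_card (by simpa using this) (by simpa using h)

/-- The number of elements of an orbit of a permutation. -/
noncomputable def Equiv.Perm.Orbits.length {α : Type*} [Fintype α] {σ : Perm α} (o : σ.Orbits) :
    ℕ :=
  Quotient.lift (fun x => minimalPeriod σ x) (fun x y (h : σ.SameCycle x y) => by
    classical
    rw [σ.minimalPeriod_eq_card_sameCycle x y h,
      σ.minimalPeriod_eq_card_sameCycle x x (Perm.SameCycle.refl _ _)]) o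

@[simp] theorem Equiv.Perm.Orbits.length_mk {α : Type*} [Fintype α] {σ : Perm α} (x : α) :
    Perm.Orbits.length (σ := σ) (Quotient.mk _ x) = minimalPeriod σ x := rfl

open Classical in
theorem Equiv.Perm.sum_orbits {α : Type*} [Fintype α] (σ : Perm α) (g : σ.Orbits → ℕ) (i : ℕ) :
    ∑ x with minimalPeriod σ x = i, g (Quotient.mk _ x) =
      i * ∑ o : σ.Orbits with o.length = i, g o := by
  rw [← sum_fiberwise_of_maps_to (s := {x | minimalPeriod σ x = i})
    (t := ({o | o.length = i} : Finset σ.Orbits)) (g := fun x => Quotient.mk _ x)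
    (by simp), mul_sum]
  refine sum_congr rfl fun o ho => ?_
  induction o using Quotient.inductionOn with | _ x =>
  simp only [mem_filter, mem_univ, true_and, Perm.Orbits.length_mk] at ho
  rw [sum_congr rfl (g := fun _ => g (Quotient.mk _ x)) (fun y hy => by rw [(mem_filter.1 hy).2]),
    sum_const, smul_eq_mul]
  congr 1
  rw [← ho, σ.minimalPeriod_eq_card_sameCycle x x (Perm.SameCycle.refl _ _)]
  congr 1
  ext y
  simp only [mem_filter, mem_univ, true_and]
  constructor
  · rintro ⟨-, h⟩
    exact (Quotient.exact h).symm
  · intro h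
    refine ⟨?_, Quotient.sound (s := Perm.SameCycle.setoid σ) h.symm⟩
    exact (σ.minimalPeriod_eq_card_sameCycle x y h)

/-- Counting functions on a finite type with prescribed sums over the fibres of a map. -/
theorem card_fun_sum_fiber_eq {O ι : Type*} [Fintype O] [DecidableEq ι] (ℓ : O → ι) (I : Finset ι)
    (hℓ : ∀ o, ℓ o ∈ I) (m : ι → ℕ) :
    Nat.card {g : O → ℕ // ∀ i ∈ I, ∑ o with ℓ o = i, g o = m i} =
      ∏ i ∈ I, Nat.multichoose #{o | ℓ o = i} (m i) := by
  classical
  -- The conditions on different fibres are independent, and on one fibre a solution is a multiset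
  -- of size `m i`.
  have e : {g : O → ℕ // ∀ i ∈ I, ∑ o with ℓ o = i, g o = m i} ≃
      ∀ i : I, {h : {o // ℓ o = i} → ℕ // ∑ o, h o = m i} :=
    { toFun g i := ⟨fun o => g.1 o, by
        rw [← g.2 i i.2]
        exact (sum_subtype _ (by simp) _).symm⟩
      invFun h := ⟨fun o => (h ⟨ℓ o, hℓ o⟩).1 ⟨o, rfl⟩, fun i hi => by
        rw [← (h ⟨i, hi⟩).2, sum_subtype (p := fun o => ℓ o = i) _ (by simp)]
        refine sum_congr rfl ?_
        rintro ⟨o, rfl⟩ -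
        rfl⟩
      left_inv g := rfl
      right_inv h := by
        refine funext fun ⟨i, hi⟩ => Subtype.ext (funext ?_)
        rintro ⟨o, (rfl : ℓ o = i)⟩
        rfl }
  rw [Nat.card_congr e, Nat.card_pi, ← prod_coe_sort I]
  refine prod_congr rfl fun i _ => ?_
  rw [← Nat.card_congr (Sym.equivNatSumOfFintype _ _), Nat.card_eq_fintype_card,
    Sym.card_sym_eq_multichoose, Fintype.card_subtype]

theorem Equiv.Perm.SameCycle.apply_eq_of_invariant {α β : Type*} [Finite α] {σ : Perm α}
    {c : α → β} (hc : ∀ x, c (σ x) = c x) {x y : α} (h : σ.SameCycle x y) : c x = c y := by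
  obtain ⟨k, rfl⟩ := h.exists_nat_pow_eq
  induction k with
  | zero => rfl
  | succ k ih => rw [pow_succ', Perm.mul_apply, hc, ← ih ⟨k, by simp⟩]

open Classical in
theorem Equiv.Perm.card_minimalPeriod_eq_mul_card_orbits {α : Type*} [Fintype α] (σ : Perm α)
    (i : ℕ) : #{x | minimalPeriod σ x = i} = i * #{o : σ.Orbits | o.length = i} := by
  simpa using σ.sum_orbits (fun _ => 1) i

open Classical in
/-- Counting the invariant functions of a permutation with prescribed sums over the points of each
period. -/
theorem Equiv.Perm.card_invariant_sum_eq {α : Type*} [Fintype α] (σ : Perm α) (I : Finset ℕ)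
    (hI : ∀ i ∈ I, i ≠ 0) (hσ : ∀ x, minimalPeriod σ x ∈ I) (m : ℕ → ℕ) :
    Nat.card {c : α → ℕ // (∀ x, c (σ x) = c x) ∧
        ∀ i ∈ I, ∑ x with minimalPeriod σ x = i, c x = i * m i} =
      ∏ i ∈ I, Nat.multichoose #{o : σ.Orbits | o.length = i} (m i) := by
  rw [← card_fun_sum_fiber_eq (fun o : σ.Orbits => o.length) I
    (fun o => Quotient.inductionOn o hσ) m]
  exact (Nat.card_congr
    { toFun g := ⟨fun x => g.1 (Quotient.mk _ x),
        fun x => congrArg g.1 (Quotient.sound (s := Perm.SameCycle.setoid σ)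
          (Perm.sameCycle_apply_left.2 (Perm.SameCycle.refl _ _))),
        fun i hi => by rw [σ.sum_orbits, g.2 i hi]⟩
      invFun c := ⟨Quotient.lift c.1 fun x y (h : σ.SameCycle x y) =>
        h.apply_eq_of_invariant c.2.1, fun i hi => by
          refine Nat.eq_of_mul_eq_mul_left (Nat.pos_of_ne_zero (hI i hi)) ?_
          rw [← σ.sum_orbits, ← c.2.2 i hi]
          rfl⟩
      left_inv g := Subtype.ext (funext fun o => Quotient.inductionOn o fun _ => rfl)
      right_inv c := rfl }).symm

/-! ### Sorted labellings of a fixed permutation -/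

theorem card_strictMono_fin (n N : ℕ) :
    Nat.card {g : Fin n → Fin N // StrictMono g} = N.choose n := by
  have e : {g : Fin n → Fin N // StrictMono g} ≃ (Fin n ↪o Fin N) :=
    { toFun g := OrderEmbedding.ofStrictMono g.1 g.2
      invFun f := ⟨f, f.strictMono⟩ }
  rw [Nat.card_congr (e.trans Set.powersetCard.ofFinEmbEquiv), Set.powersetCard.card, Nat.card_fin]

/-- `x` minus the number of descents of `π` before position `x`. -/
def ascentHeight {k : ℕ} (π : Perm (Fin (k + 1))) (x : Fin (k + 1)) : ℤ :=
  (x : ℤ) - #{j ∈ descentSet π | j < x}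

theorem mem_descentSet_castSucc {k : ℕ} (π : Perm (Fin (k + 1))) (i : Fin k) :
    i.castSucc ∈ descentSet π ↔ π i.succ < π i.castSucc := by
  simp [descentSet, Fin.succ]

theorem ascentHeight_zero {k : ℕ} (π : Perm (Fin (k + 1))) : ascentHeight π 0 = 0 := by
  simp [ascentHeight]

theorem ascentHeight_last {k : ℕ} (π : Perm (Fin (k + 1))) :
    ascentHeight π (Fin.last k) = k - descentNumber π := by
  have : {j ∈ descentSet π | j < Fin.last k} = descentSet π := by
    refine filter_true_of_mem fun j hj => ?_
    simp only [descentSet, mem_filter, mem_univ, true_and] at hj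
    obtain ⟨h, -⟩ := hj
    rw [Fin.lt_def, Fin.val_last]
    omega
  simp [ascentHeight, this, descentNumber]

theorem ascentHeight_succ {k : ℕ} (π : Perm (Fin (k + 1))) (i : Fin k) :
    ascentHeight π i.succ =
      ascentHeight π i.castSucc + if π i.succ < π i.castSucc then 0 else 1 := by
  have h : {j ∈ descentSet π | j < i.succ} =
      {j ∈ descentSet π | j < i.castSucc} ∪ {j ∈ descentSet π | j = i.castSucc} := by
    ext j
    simp only [mem_filter, mem_union, ← and_or_left, Fin.lt_def, Fin.ext_iff, Fin.val_succ,
      Fin.val_castSucc]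
    refine and_congr_right fun _ => by omega
  have hd : Disjoint {j ∈ descentSet π | j < i.castSucc}
      {j ∈ descentSet π | j = i.castSucc} := by
    rw [disjoint_filter]
    rintro j - h1 rfl
    exact lt_irrefl _ h1
  rw [ascentHeight, h, card_union_of_disjoint hd, filter_eq', ascentHeight]
  simp only [mem_descentSet_castSucc]
  split_ifs
  · simp
  · simp
    ring

/-- Consecutive labels must rise strictly at a descent and weakly at an ascent; the height gains one
exactly at the ascents, making both conditions strict. -/
theorem toLex_strictMono_iff {k a : ℕ} (π : Perm (Fin (k + 1))) (s : Fin (k + 1) → Fin a) :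
    (StrictMono fun x => toLex (s x, π x)) ↔
      StrictMono fun x => ((s x : ℕ) : ℤ) + ascentHeight π x := by
  rw [Fin.strictMono_iff_lt_succ, Fin.strictMono_iff_lt_succ]
  refine forall_congr' fun i => ?_
  rw [ascentHeight_succ, Prod.Lex.toLex_lt_toLex]
  have hne : π i.castSucc ≠ π i.succ := π.injective.ne (by simp [Fin.ext_iff])
  simp only [Fin.lt_def, Fin.ext_iff, ne_eq] at hne ⊢
  split_ifs <;> omega

/-- Adding the height, which ends at n - 1 - d(π), gives all strictly increasing maps into a range
lengthened by that amount; subtracting it is the inverse. -/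
theorem card_strictMono_toLex {n a : ℕ} (hn : 1 ≤ n) (π : Perm (Fin n)) :
    Nat.card {s : Fin n → Fin a // StrictMono fun x => toLex (s x, π x)} =
      (a + (n - 1 - descentNumber π)).choose n := by
  obtain ⟨k, rfl⟩ := Nat.exists_eq_add_of_le' hn
  simp only [toLex_strictMono_iff]
  have hmono : Monotone (ascentHeight π) := by
    rw [Fin.monotone_iff_le_succ]
    intro i
    rw [ascentHeight_succ]
    split_ifs <;> omega
  have h0 := fun x => (ascentHeight_zero π).symm.le.trans (hmono (Fin.zero_le x))
  have h1 := fun x => (hmono (Fin.le_last x)).trans (ascentHeight_last π).le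
  have hN : ((k + 1 - 1 - descentNumber π : ℕ) : ℤ) = k - descentNumber π := by
    have := (h0 (Fin.last k)).trans (h1 _)
    omega
  rw [← card_strictMono_fin]
  have hsub : ∀ g : Fin (k + 1) → Fin (a + (k + 1 - 1 - descentNumber π)), StrictMono g →
      Monotone fun x => ((g x : ℕ) : ℤ) - ascentHeight π x := by
    intro g hg
    rw [Fin.monotone_iff_le_succ]
    intro i
    have := Fin.lt_def.1 (hg (Fin.castSucc_lt_succ (i := i)))
    simp only [ascentHeight_succ]
    split_ifs <;> omega
  have hb : ∀ g : Fin (k + 1) → Fin (a + (k + 1 - 1 - descentNumber π)), StrictMono g →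
      ∀ x, ascentHeight π x ≤ (g x : ℕ) ∧ ((g x : ℕ) : ℤ) - ascentHeight π x < a := by
    intro g hg x
    have h2 := hsub g hg (Fin.zero_le x)
    have h3 := hsub g hg (Fin.le_last x)
    have h4 := (g (Fin.last k)).2
    simp only [ascentHeight_zero, ascentHeight_last] at h2 h3
    omega
  exact Nat.card_congr
    { toFun s := ⟨fun x => ⟨((s.1 x : ℕ) + ascentHeight π x).toNat, by
          have := h1 x
          have := (s.1 x).2
          omega⟩, fun x y hxy => by
        have := s.2 hxy
        have := h0 x
        have := h0 y
        simp only [Fin.lt_def] at *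
        omega⟩
      invFun g := ⟨fun x => ⟨((g.1 x : ℕ) - ascentHeight π x).toNat, by
          have := hb g.1 g.2 x
          omega⟩, fun x y hxy => by
        have := hb g.1 g.2 x
        have := hb g.1 g.2 y
        have := Fin.lt_def.1 (g.2 hxy)
        simp only
        omega⟩
      left_inv s := by
        refine Subtype.ext (funext fun x => Fin.ext ?_)
        have := h0 x
        simp only
        omega
      right_inv g := by
        refine Subtype.ext (funext fun x => Fin.ext ?_)
        have := hb g.1 g.2 x
        simp only
        omega }

/-! ### Periodic words and primitive necklaces -/

/-- The shift on infinite words. -/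
def wordShift {α : Type*} (w : Lex (ℕ → α)) : Lex (ℕ → α) := toLex fun k => ofLex w (k + 1)

theorem wordShift_iterate {α : Type*} (j : ℕ) (w : Lex (ℕ → α)) :
    wordShift^[j] w = toLex fun k => ofLex w (k + j) := by
  induction j generalizing w with
  | zero => rfl
  | succ j ih =>
    rw [Function.iterate_succ_apply, ih]
    refine congrArg toLex (funext fun k => ?_)
    simp [wordShift, add_assoc]

theorem isPeriodicPt_wordShift_iff {α : Type*} {i : ℕ} {w : Lex (ℕ → α)} :
    IsPeriodicPt wordShift i w ↔ ∀ k, ofLex w (k + i) = ofLex w k := by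
  rw [IsPeriodicPt, Function.IsFixedPt, wordShift_iterate]
  exact funext_iff

theorem word_lt_iff {α : Type*} [LinearOrder α] {v w : Lex (ℕ → α)} :
    v < w ↔ ofLex v 0 < ofLex w 0 ∨ ofLex v 0 = ofLex w 0 ∧ wordShift v < wordShift w := by
  change (∃ i, (∀ j < i, ofLex v j = ofLex w j) ∧ ofLex v i < ofLex w i) ↔
    _ ∨ _ ∧ ∃ i, (∀ j < i, ofLex v (j + 1) = ofLex w (j + 1)) ∧ ofLex v (i + 1) < ofLex w (i + 1)
  constructor
  · rintro ⟨i, h, hi⟩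
    cases i with
    | zero => exact Or.inl hi
    | succ i => exact Or.inr ⟨h 0 i.succ_pos, i, fun j hj => h _ (by omega), hi⟩
  · rintro (h | ⟨h0, i, h, hi⟩)
    · exact ⟨0, by simp, h⟩
    · refine ⟨i + 1, fun j hj => ?_, hi⟩
      cases j with
      | zero => exact h0
      | succ j => exact h j (by omega)

/-- A word of period `i` is determined by its first `i` letters. -/
def periodicWordEquiv (α : Type*) {i : ℕ} (hi : 0 < i) :
    {w : Lex (ℕ → α) // IsPeriodicPt wordShift i w} ≃ (Fin i → α) where
  toFun w k := ofLex w.1 k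
  invFun g := ⟨toLex fun k => g ⟨k % i, Nat.mod_lt _ hi⟩, by
    rw [isPeriodicPt_wordShift_iff]
    simp⟩
  left_inv w := by
    refine Subtype.ext (funext fun k => ?_)
    have h := isPeriodicPt_wordShift_iff.1 w.2
    change ofLex w.1 (k % i) = ofLex w.1 k
    exact Function.Periodic.map_mod_nat h k
  right_inv g := by
    ext k
    simp [Nat.mod_eq_of_lt k.2]

theorem finite_isPeriodicPt_wordShift (α : Type*) [Finite α] {i : ℕ} (hi : 0 < i) :
    Finite {w : Lex (ℕ → α) // IsPeriodicPt wordShift i w} :=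
  Finite.of_equiv _ (periodicWordEquiv α hi).symm

/-- The words of minimal period `i`. -/
abbrev PrimitiveWord (α : Type*) (i : ℕ) : Type _ :=
  {w : Lex (ℕ → α) // minimalPeriod wordShift w = i}

theorem finite_primitiveWord (α : Type*) [Finite α] {i : ℕ} (hi : 0 < i) :
    Finite (PrimitiveWord α i) :=
  have := finite_isPeriodicPt_wordShift α hi
  Finite.of_injective (fun w : PrimitiveWord α i =>
    (⟨w.1, Function.isPeriodicPt_iff_minimalPeriod_dvd.2 w.2.dvd⟩ :
      {w : Lex (ℕ → α) // IsPeriodicPt wordShift i w}))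
    fun _ _ h => Subtype.ext (congrArg (fun x => x.1) h)

theorem sum_card_primitiveWord (α : Type*) [Finite α] {i : ℕ} (hi : 0 < i) :
    ∑ d ∈ i.divisors, Nat.card (PrimitiveWord α d) = Nat.card α ^ i := by
  have := finite_isPeriodicPt_wordShift α hi
  have h1 : Nat.card {w : Lex (ℕ → α) // IsPeriodicPt wordShift i w} = Nat.card α ^ i := by
    rw [Nat.card_congr (periodicWordEquiv α hi), Nat.card_fun, Nat.card_fin]
  let f : {w : Lex (ℕ → α) // IsPeriodicPt wordShift i w} → i.divisors := fun w =>
    ⟨minimalPeriod wordShift w.1, Nat.mem_divisors.2 ⟨w.2.minimalPeriod_dvd, hi.ne'⟩⟩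
  rw [← h1, Nat.card_congr (Equiv.sigmaFiberEquiv f).symm, Nat.card_sigma,
    ← sum_coe_sort i.divisors]
  refine sum_congr rfl fun d _ => Nat.card_congr
    { toFun w := ⟨⟨w.1, Function.isPeriodicPt_iff_minimalPeriod_dvd.2
        (w.2.dvd.trans (Nat.dvd_of_mem_divisors d.2))⟩, Subtype.ext w.2⟩
      invFun w := ⟨w.1.1, congrArg Subtype.val w.2⟩ }

/-- Möbius inversion of `sum_card_primitiveWord`. The factor i appears because a primitive necklace
of length i has i distinct rotations. -/
theorem card_primitiveWord (a : ℕ) {i : ℕ} (hi : 0 < i) :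
    (Nat.card (PrimitiveWord (Fin a) i) : ℚ) = i * necklaceNumber i a := by
  have h := (ArithmeticFunction.sum_eq_iff_sum_mul_moebius_eq
    (f := fun i => (Nat.card (PrimitiveWord (Fin a) i) : ℚ)) (g := fun i => (a : ℚ) ^ i)).1
    (fun i hi => by
      have := sum_card_primitiveWord (Fin a) hi
      rw [Nat.card_fin] at this
      exact_mod_cast this) i hi
  rw [← h, necklaceNumber, ← mul_assoc, mul_one_div_cancel (by exact_mod_cast hi.ne'), one_mul,
    Nat.sum_divisorsAntidiagonal (fun d e => ((ArithmeticFunction.moebius d : ℤ) : ℚ) * (a : ℚ) ^ e)]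
  simp

/-- The periodic words of minimal period at most `n`. -/
abbrev PeriodicWord (α : Type*) (n : ℕ) : Type _ :=
  {w : Lex (ℕ → α) // minimalPeriod wordShift w ∈ Icc 1 n}

theorem PeriodicWord.mem_periodicPts {α : Type*} {n : ℕ} (w : PeriodicWord α n) :
    w.1 ∈ Function.periodicPts wordShift :=
  Function.minimalPeriod_pos_iff_mem_periodicPts.1 (mem_Icc.1 w.2).1

instance (α : Type*) [Finite α] (n : ℕ) : Finite (PeriodicWord α n) := by
  have : ∀ i : Icc 1 n, Finite (PrimitiveWord α i) := fun i =>
    finite_primitiveWord α (mem_Icc.1 i.2).1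
  exact Finite.of_injective (fun w : PeriodicWord α n =>
    (⟨⟨_, w.2⟩, ⟨w.1, rfl⟩⟩ : Σ i : Icc 1 n, PrimitiveWord α i)) fun v w h => by
      have := congrArg (fun x : Σ i : Icc 1 n, PrimitiveWord α i => x.2.1) h
      exact Subtype.ext this

noncomputable instance (α : Type*) [Finite α] (n : ℕ) : Fintype (PeriodicWord α n) :=
  Fintype.ofFinite _

/-- The shift as a permutation of the periodic words. -/
noncomputable def PeriodicWord.shift (α : Type*) [Finite α] (n : ℕ) : Perm (PeriodicWord α n) :=
  Equiv.ofBijective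
    (fun w => ⟨wordShift w.1, by rw [Function.minimalPeriod_apply w.mem_periodicPts]; exact w.2⟩)
    (Finite.injective_iff_bijective.1 fun v w h => Subtype.ext <| by
      obtain ⟨i, hi, hv⟩ := v.mem_periodicPts
      obtain ⟨j, hj, hw⟩ := w.mem_periodicPts
      exact Function.IsPeriodicPt.eq_of_apply_eq hv hw hi hj (congrArg Subtype.val h))

theorem Function.Semiconj.minimalPeriod_eq_of_injective {α β : Type*} {f : α → α} {g : β → β}
    {φ : α → β} (h : Function.Semiconj φ f g) {x : α}
    (hφ : ∀ k, φ (f^[k] x) = φ x → f^[k] x = x) : minimalPeriod g (φ x) = minimalPeriod f x := by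
  rw [Function.minimalPeriod_eq_minimalPeriod_iff]
  intro k
  have := h.iterate_right k x
  exact ⟨fun hk => hφ k (this.trans hk), fun hk => hk.map h⟩

theorem PeriodicWord.minimalPeriod_shift {α : Type*} [Finite α] {n : ℕ} (w : PeriodicWord α n) :
    minimalPeriod (PeriodicWord.shift α n) w = minimalPeriod wordShift w.1 :=
  (Function.Semiconj.minimalPeriod_eq_of_injective (φ := Subtype.val) (fun _ => rfl)
    fun _ h => Subtype.ext h).symm

open Classical in
theorem PeriodicWord.card_orbits (a n : ℕ) {i : ℕ} (hi : i ∈ Icc 1 n) :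
    (#{o : (PeriodicWord.shift (Fin a) n).Orbits | o.length = i} : ℚ) = necklaceNumber i a := by
  have hi0 : (i : ℚ) ≠ 0 := by
    have := (mem_Icc.1 hi).1
    exact_mod_cast (by omega : i ≠ 0)
  refine mul_left_cancel₀ hi0 ?_
  rw [← card_primitiveWord a (mem_Icc.1 hi).1, ← Nat.cast_mul,
    ← Perm.card_minimalPeriod_eq_mul_card_orbits, ← Fintype.card_subtype, ← Nat.card_eq_fintype_card]
  refine congrArg _ (Nat.card_congr
    { toFun w := ⟨w.1.1, w.1.minimalPeriod_shift.symm.trans w.2⟩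
      invFun w := ⟨⟨w.1, by rw [w.2]; exact hi⟩, (PeriodicWord.minimalPeriod_shift _).trans w.2⟩ })

/-! ### Words along the orbits of a sorted pair -/

/-- The word read off from the labels `s` along the orbit of `x` under `π`. -/
def orbitWord {β α : Type*} (π : β → β) (s : β → α) (x : β) : Lex (ℕ → α) :=
  toLex fun k => s (π^[k] x)

theorem orbitWord_apply {β α : Type*} (π : β → β) (s : β → α) (x : β) :
    orbitWord π s (π x) = wordShift (orbitWord π s x) := rfl

section Sorted

variable {β α : Type*} [LinearOrder β] [LinearOrder α] {π : β → β} {s : β → α}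

theorem StrictMono.apply_lt_of_label_eq (h : StrictMono fun x => toLex (s x, π x)) {x y : β}
    (hxy : x < y) (hs : s x = s y) : π x < π y := by
  rcases Prod.Lex.toLex_lt_toLex.1 (h hxy) with h | h
  · exact absurd hs h.ne
  · exact h.2

theorem StrictMono.label_monotone (h : StrictMono fun x => toLex (s x, π x)) : Monotone s := by
  intro x y hxy
  rcases hxy.eq_or_lt with rfl | hxy
  · rfl
  rcases Prod.Lex.toLex_lt_toLex.1 (h hxy) with h | h
  · exact h.le
  · exact h.1.le

theorem StrictMono.iterate_lt_of_label_eq (h : StrictMono fun x => toLex (s x, π x)) {x y : β}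
    (hxy : x < y) (k : ℕ) (hk : ∀ j < k, s (π^[j] x) = s (π^[j] y)) : π^[k] x < π^[k] y := by
  induction k with
  | zero => exact hxy
  | succ k ih =>
    rw [Function.iterate_succ_apply', Function.iterate_succ_apply']
    exact h.apply_lt_of_label_eq (ih fun j hj => hk j (by omega)) (hk k (by omega))

/-- While the labels agree, the iterates of x and y keep their strict order; at the first
disagreement the monotonicity of s decides. -/
theorem StrictMono.orbitWord_monotone (h : StrictMono fun x => toLex (s x, π x)) :
    Monotone (orbitWord π s) := by
  intro x y hxy
  rcases hxy.eq_or_lt with rfl | hxy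
  · rfl
  by_contra! hlt
  obtain ⟨i, hi, hlt⟩ := hlt
  exact hlt.not_ge (h.label_monotone (h.iterate_lt_of_label_eq hxy i fun j hj => (hi j hj).symm).le)

theorem StrictMono.iterate_lt_of_orbitWord_eq (h : StrictMono fun x => toLex (s x, π x)) {x y : β}
    (hxy : x < y) (he : orbitWord π s x = orbitWord π s y) (k : ℕ) : π^[k] x < π^[k] y :=
  h.iterate_lt_of_label_eq hxy k fun j _ => congrFun he j

/-- The word along an orbit is primitive. -/
theorem StrictMono.iterate_eq_of_orbitWord_eq [Finite β]
    (h : StrictMono fun x => toLex (s x, π x)) {x : β} {k : ℕ}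
    (he : orbitWord π s (π^[k] x) = orbitWord π s x) : π^[k] x = x := by
  have hj : ∀ j, (π^[k])^[j + 1] x = π^[k * j] (π^[k] x) := fun j => by
    rw [Function.iterate_succ_apply, ← Function.iterate_mul]
  have hj' : ∀ j, (π^[k])^[j] x = π^[k * j] x := fun j => by
    rw [← Function.iterate_mul]
  by_contra hne
  -- Equal words keep the order of iterates forever, so the points π^[k * j] x would form an
  -- infinite strictly monotone sequence in a finite type.
  rcases lt_or_gt_of_ne hne with hlt | hlt
  · refine not_injective_infinite_finite (fun j => (π^[k])^[j] x)
      (strictAnti_nat_of_succ_lt fun j => ?_).injective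
    rw [hj, hj']
    exact h.iterate_lt_of_orbitWord_eq hlt he _
  · refine not_injective_infinite_finite (fun j => (π^[k])^[j] x)
      (strictMono_nat_of_lt_succ fun j => ?_).injective
    rw [hj, hj']
    exact h.iterate_lt_of_orbitWord_eq hlt he.symm _

theorem StrictMono.minimalPeriod_orbitWord [Finite β]
    (h : StrictMono fun x => toLex (s x, π x)) (x : β) :
    minimalPeriod wordShift (orbitWord π s x) = minimalPeriod π x :=
  Function.Semiconj.minimalPeriod_eq_of_injective (φ := orbitWord π s) (f := π) (fun _ => rfl)
    fun _ => h.iterate_eq_of_orbitWord_eq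

end Sorted

/-- Matching the fibres makes V a rearrangement of W, and a sorted rearrangement is unique. -/
theorem Monotone.eq_of_card_fiber_eq {n : ℕ} {X : Type*} [LinearOrder X] {V W : Fin n → X}
    (hV : Monotone V) (hW : Monotone W) (h : ∀ w, #{x | V x = w} = #{x | W x = w}) : V = W := by
  let e : Perm (Fin n) := (Equiv.sigmaFiberEquiv V).symm.trans ((Equiv.sigmaCongrRight fun w =>
    Fintype.equivOfCardEq (α := {x // V x = w}) (β := {x // W x = w})
      (by rw [Fintype.card_subtype, Fintype.card_subtype, h])).trans (Equiv.sigmaFiberEquiv W))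
  have he : W ∘ e = V := funext fun x =>
    (Fintype.equivOfCardEq (α := {y // V y = V x}) (β := {y // W y = V x})
      (by rw [Fintype.card_subtype, Fintype.card_subtype, h]) ⟨x, rfl⟩).2
  have := Tuple.unique_monotone (f := W) (σ := e) (τ := 1) (by rwa [he]) hW
  rw [← he, this]
  rfl

/-! ### The Gessel–Reutenauer bijection -/

section Bijection

variable {n a : ℕ}

/-- The words along the orbits of a sorted pair, as periodic words. -/
def periodicOrbitWord (π : Perm (Fin n)) (s : Fin n → Fin a)
    (h : StrictMono fun x => toLex (s x, π x)) (x : Fin n) : PeriodicWord (Fin a) n :=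
  ⟨orbitWord π s x, by
    rw [h.minimalPeriod_orbitWord, mem_Icc]
    exact ⟨π.minimalPeriod_pos x, by
      simpa using Function.minimalPeriod_le_card (f := π) (x := x)⟩⟩

/-- The multiplicities of the words along the orbits of `π`. -/
noncomputable def wordMultiplicity (π : Perm (Fin n)) (s : Fin n → Fin a)
    (w : PeriodicWord (Fin a) n) : ℕ :=
  #{x | orbitWord π s x = w.1}

theorem wordMultiplicity_shift {π : Perm (Fin n)} {s : Fin n → Fin a}
    (h : StrictMono fun x => toLex (s x, π x)) (w : PeriodicWord (Fin a) n) :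
    wordMultiplicity π s (PeriodicWord.shift _ n w) = wordMultiplicity π s w := by
  symm
  refine card_equiv π fun x => ?_
  simp only [mem_filter, mem_univ, true_and]
  have h1 := (PeriodicWord.shift (Fin a) n).apply_eq_iff_eq (x := periodicOrbitWord π s h x) (y := w)
  exact ⟨fun hx => congrArg Subtype.val (h1.2 (Subtype.ext hx)),
    fun hx => congrArg Subtype.val (h1.1 (Subtype.ext hx))⟩

theorem sum_wordMultiplicity {π : Perm (Fin n)} {s : Fin n → Fin a}
    (h : StrictMono fun x => toLex (s x, π x)) (i : ℕ) :
    ∑ w with minimalPeriod (PeriodicWord.shift (Fin a) n) w = i, wordMultiplicity π s w =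
      #{x | minimalPeriod π x = i} := by
  rw [card_eq_sum_card_fiberwise (f := periodicOrbitWord π s h)
    (t := {w | minimalPeriod (PeriodicWord.shift (Fin a) n) w = i})]
  · refine sum_congr rfl fun w hw => congrArg card ?_
    ext x
    simp only [mem_filter, mem_univ, true_and, PeriodicWord.minimalPeriod_shift] at hw ⊢
    refine ⟨fun hx => ⟨?_, Subtype.ext hx⟩, fun hx => congrArg Subtype.val hx.2⟩
    rw [← hw, ← hx, h.minimalPeriod_orbitWord]
  · intro x hx
    simp only [coe_filter, mem_univ, true_and, Set.mem_ofPred_eq,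
      PeriodicWord.minimalPeriod_shift] at hx ⊢
    rw [← hx]
    exact h.minimalPeriod_orbitWord x

/-- The multiplicities determine the sorted sequence of words, whose first letters are the labels;
the permutation is then recovered from the order. -/
theorem wordMultiplicity_injective {π ρ : Perm (Fin n)} {s r : Fin n → Fin a}
    (h : StrictMono fun x => toLex (s x, π x)) (h' : StrictMono fun x => toLex (r x, ρ x))
    (he : wordMultiplicity π s = wordMultiplicity ρ r) : π = ρ ∧ s = r := by
  have hW : periodicOrbitWord π s h = periodicOrbitWord ρ r h' := by
    refine Monotone.eq_of_card_fiber_eq (fun x y hxy => h.orbitWord_monotone hxy)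
      (fun x y hxy => h'.orbitWord_monotone hxy) fun w => ?_
    simpa only [periodicOrbitWord, wordMultiplicity, Subtype.ext_iff] using congrFun he w
  have hW1 : ∀ x, orbitWord π s x = orbitWord ρ r x := fun x => congrArg Subtype.val (congrFun hW x)
  have hs : s = r := funext fun x => congrFun (hW1 x) 0
  have hshift : ∀ x, orbitWord π s (ρ x) = orbitWord π s (π x) := fun x => by
    rw [hW1, orbitWord_apply, orbitWord_apply, hW1]
  refine ⟨?_, hs⟩
  -- If the words at π u and π v differ, they order ρ u and ρ v. If they agree, so do the words at u
  -- and v, because the shift is injective, and both permutations then preserve the order of u and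
  -- v.
  have hmono : StrictMono (ρ * π⁻¹) := by
    intro x y hxy
    obtain ⟨u, rfl⟩ := π.surjective x
    obtain ⟨v, rfl⟩ := π.surjective y
    have hinv : ∀ u, (ρ * π⁻¹) (π u) = ρ u := fun u => by simp
    rw [hinv, hinv]
    rcases (h.orbitWord_monotone hxy.le).eq_or_lt with heq | hlt
    · have hT : periodicOrbitWord π s h u = periodicOrbitWord π s h v :=
        (PeriodicWord.shift (Fin a) n).injective (Subtype.ext heq)
      have huv : s u = s v := congrFun (congrArg Subtype.val hT) 0
      rcases lt_trichotomy u v with hlt | rfl | hlt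
      · exact h'.apply_lt_of_label_eq hlt (by rw [← hs, huv])
      · exact absurd hxy (lt_irrefl _)
      · exact absurd (h.apply_lt_of_label_eq hlt huv.symm) hxy.not_gt
    · rw [← hshift, ← hshift] at hlt
      exact h.orbitWord_monotone.reflect_lt hlt
  have hid : hmono.orderIsoOfSurjective _ (ρ * π⁻¹).surjective = OrderIso.refl _ :=
    Subsingleton.elim _ _
  have : ρ * π⁻¹ = 1 := Equiv.ext fun x => congrArg (fun f : Fin n ≃o Fin n => f x) hid
  exact (mul_inv_eq_one.1 this).symm

/-- Take c w numbered copies of each word w, ordered by word and then by number, and identify them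
with `Fin n`. The permutation shifts the word and keeps the number; the label is the first letter.
-/
theorem wordMultiplicity_surjective (c : PeriodicWord (Fin a) n → ℕ)
    (hc : ∀ w, c (PeriodicWord.shift _ n w) = c w) (hn : ∑ w, c w = n) :
    ∃ (π : Perm (Fin n)) (s : Fin n → Fin a) (_ : StrictMono fun x => toLex (s x, π x)),
      wordMultiplicity π s = c := by
  let Y := {p : PeriodicWord (Fin a) n ×ₗ ℕ // (ofLex p).2 < c (ofLex p).1}
  let eY : Y ≃ Σ w, Fin (c w) :=
    { toFun p := ⟨(ofLex p.1).1, ⟨(ofLex p.1).2, p.2⟩⟩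
      invFun q := ⟨toLex (q.1, q.2), q.2.2⟩ }
  have : Fintype Y := Fintype.ofEquiv _ eY.symm
  have hcard : Fintype.card Y = n := by
    rw [Fintype.card_congr eY, Fintype.card_sigma]
    simpa using hn
  let T : Perm Y :=
    { toFun p := ⟨toLex (PeriodicWord.shift _ n (ofLex p.1).1, (ofLex p.1).2), by
        simpa [hc] using p.2⟩
      invFun p := ⟨toLex ((PeriodicWord.shift _ n).symm (ofLex p.1).1, (ofLex p.1).2), by
        have := hc ((PeriodicWord.shift _ n).symm (ofLex p.1).1)
        rw [Equiv.apply_symm_apply] at this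
        simpa [← this] using p.2⟩
      left_inv p := by simp
      right_inv p := by simp }
  let e : Fin n ≃o Y := Fintype.orderIsoFinOfCardEq Y hcard
  let π : Perm (Fin n) := e.toEquiv.trans (T.trans e.symm.toEquiv)
  let s : Fin n → Fin a := fun x => ofLex (ofLex (e x).1).1.1 0
  have hπ : ∀ x, e (π x) = T (e x) := fun x => e.apply_symm_apply _
  have hsorted : StrictMono fun x => toLex (s x, π x) := by
    intro x y hxy
    rw [Prod.Lex.toLex_lt_toLex]
    have hcond : T (e x) < T (e y) → π x < π y := fun h => e.symm.strictMono h
    rcases Prod.Lex.lt_iff.1 (show (e x).1 < (e y).1 from e.strictMono hxy) with h | ⟨h1, h2⟩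
    · rcases word_lt_iff.1 (show (ofLex (e x).1).1.1 < (ofLex (e y).1).1.1 from h) with h | ⟨h1, h2⟩
      · exact Or.inl h
      · exact Or.inr ⟨h1, hcond (Prod.Lex.lt_iff.2 (Or.inl h2))⟩
    · exact Or.inr ⟨by simp only [s, h1],
        hcond (Prod.Lex.lt_iff.2 (Or.inr ⟨congrArg (PeriodicWord.shift _ n) h1, h2⟩))⟩
  have hword : ∀ k x, ofLex (orbitWord π s x) k = ofLex (ofLex (e x).1).1.1 k := by
    intro k
    induction k with
    | zero => exact fun _ => rfl
    | succ k ih =>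
      intro x
      refine (ih (π x)).trans ?_
      rw [hπ]
      rfl
  refine ⟨π, s, hsorted, funext fun w => ?_⟩
  have h1 : wordMultiplicity π s w = #{p : Y | (ofLex p.1).1 = w} := by
    refine card_equiv e.toEquiv fun x => ?_
    simp only [mem_filter, mem_univ, true_and]
    rw [Subtype.ext_iff]
    have : orbitWord π s x = (ofLex (e x).1).1.1 := funext fun k => hword k x
    rw [this]
    rfl
  rw [h1, ← Fintype.card_subtype, ← Fintype.card_fin (c w)]
  exact Fintype.card_congr
    { toFun p := ⟨(ofLex p.1.1).2, by have := p.1.2; rwa [p.2] at this⟩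
      invFun j := ⟨⟨toLex (w, j), j.2⟩, rfl⟩
      left_inv p := by
        obtain ⟨p, rfl⟩ := p
        rfl
      right_inv j := rfl }

/-- Sorted pairs of a permutation and a labelling correspond to shift-invariant multiplicities of
periodic words. -/
theorem card_sorted_eq_card_invariant (m : ℕ → ℕ) (hm : ∑ i ∈ Icc 1 n, i * m i = n) :
    Nat.card {p : Perm (Fin n) × (Fin n → Fin a) // (StrictMono fun x => toLex (p.2 x, p.1 x)) ∧
        ∀ i ∈ Icc 1 n, #{x | minimalPeriod p.1 x = i} = i * m i} =
      Nat.card {c : PeriodicWord (Fin a) n → ℕ // (∀ w, c (PeriodicWord.shift _ n w) = c w) ∧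
        ∀ i ∈ Icc 1 n, ∑ w with minimalPeriod (PeriodicWord.shift (Fin a) n) w = i, c w =
          i * m i} := by
  refine Nat.card_eq_of_bijective (fun p => ⟨wordMultiplicity p.1.1 p.1.2,
    wordMultiplicity_shift p.2.1, fun i hi => ?_⟩) ⟨?_, ?_⟩
  · rw [sum_wordMultiplicity p.2.1, p.2.2 i hi]
  · intro p q h
    obtain ⟨h1, h2⟩ := wordMultiplicity_injective p.2.1 q.2.1 (congrArg Subtype.val h)
    exact Subtype.ext (Prod.ext h1 h2)
  · rintro ⟨c, hc, hsum⟩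
    have hn : ∑ w, c w = n := by
      rw [← sum_fiberwise_of_maps_to (t := Icc 1 n)
        (g := fun w => minimalPeriod (PeriodicWord.shift (Fin a) n) w)
        (fun w _ => by rw [PeriodicWord.minimalPeriod_shift]; exact w.2), sum_congr rfl hsum, hm]
    obtain ⟨π, s, h, rfl⟩ := wordMultiplicity_surjective c hc hn
    exact ⟨⟨(π, s), h, fun i hi => by rw [← sum_wordMultiplicity h, hsum i hi]⟩, rfl⟩

end Bijection

/-! ### Cycle types and the identity at natural a -/

theorem Nat.Partition.mem_Icc_of_mem_parts {n i : ℕ} (p : n.Partition) (hi : i ∈ p.parts) :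
    i ∈ Icc 1 n :=
  mem_Icc.2 ⟨p.parts_pos hi, by
    rw [← p.parts_sum]
    exact Multiset.le_sum_of_mem hi⟩

theorem Nat.Partition.sum_mul_count {n : ℕ} (p : n.Partition) :
    ∑ i ∈ Icc 1 n, i * p.parts.count i = n := by
  conv_rhs => rw [← p.parts_sum, Finset.sum_multiset_count]
  simp only [smul_eq_mul, mul_comm]
  refine (sum_subset (fun i hi => p.mem_Icc_of_mem_parts (Multiset.mem_toFinset.1 hi)) ?_).symm
  intro i _ hi
  rw [Multiset.mem_toFinset] at hi
  simp [hi]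

theorem Nat.Partition.parts_eq_iff {n k : ℕ} (h : k = n) (p : k.Partition) (q : n.Partition) :
    p.parts = q.parts ↔ ∀ i ∈ Icc 1 n, i * p.parts.count i = i * q.parts.count i := by
  subst h
  refine ⟨fun h i _ => by rw [h], fun h => Multiset.ext.2 fun i => ?_⟩
  by_cases hi : i ∈ Icc 1 k
  · exact Nat.eq_of_mul_eq_mul_left (mem_Icc.1 hi).1 (h i hi)
  · rw [Multiset.count_eq_zero_of_notMem fun h => hi (p.mem_Icc_of_mem_parts h),
      Multiset.count_eq_zero_of_notMem fun h => hi (q.mem_Icc_of_mem_parts h)]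

theorem mem_carrier_iff_card_minimalPeriod {n : ℕ} {lam : n.Partition}
    {C : ConjClasses (Perm (Fin n))} (hC : ∀ π ∈ C.carrier, π.partition.parts = lam.parts)
    (π : Perm (Fin n)) :
    π ∈ C.carrier ↔
      ∀ i ∈ Icc 1 n, #{x | minimalPeriod π x = i} = i * lam.parts.count i := by
  simp only [Perm.card_minimalPeriod_eq]
  rw [← Nat.Partition.parts_eq_iff (Fintype.card_fin n)]
  refine ⟨hC π, fun h => ?_⟩
  obtain ⟨σ, rfl⟩ := ConjClasses.exists_rep C
  rw [ConjClasses.mem_carrier_iff_mk_eq, ConjClasses.mk_eq_mk_iff_isConj,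
    Perm.partition_eq_of_isConj]
  exact Nat.Partition.ext (h.trans (hC σ ConjClasses.mem_carrier_mk).symm)

theorem Ring.choose_natCast_add_sub_one (N m : ℕ) :
    Ring.choose ((N : ℚ) + m - 1) m = (Nat.multichoose N m : ℚ) := by
  -- The natural subtraction N + m - 1 truncates when N = m = 0.
  rcases m with _ | m
  · simp
  · rw [Nat.multichoose_eq, ← Ring.choose_natCast]
    congr 1
    push_cast [show N + (m + 1) - 1 = N + m by omega]
    ring

theorem descentNumber_lt {n : ℕ} (hn : 1 ≤ n) (π : Perm (Fin n)) : descentNumber π < n := by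
  have h : (⟨n - 1, by omega⟩ : Fin n) ∉ descentSet π := by
    simp only [descentSet, mem_filter, mem_univ, true_and, not_exists]
    intro h
    omega
  simpa [descentNumber] using card_lt_univ_of_notMem h

open Classical in
/-- The number of multisets of primitive necklaces of given type, in terms of descents. -/
theorem sum_choose_descentNumber {n : ℕ} (hn : 1 ≤ n) (lam : n.Partition)
    (C : ConjClasses (Perm (Fin n))) (hC : ∀ π ∈ C.carrier, π.partition.parts = lam.parts)
    (a : ℕ) :
    ∑ π : Perm (Fin n) with π ∈ C.carrier,
        (((a + (n - 1 - descentNumber π)).choose n : ℕ) : ℚ) = cycleBinomialProduct lam a := by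
  have h1 := card_sorted_eq_card_invariant (n := n) (a := a) (fun i => lam.parts.count i)
    lam.sum_mul_count
  rw [Perm.card_invariant_sum_eq _ _ (fun i hi => by have := (mem_Icc.1 hi).1; omega)
    (fun w => by rw [PeriodicWord.minimalPeriod_shift]; exact w.2)] at h1
  have e : {p : Perm (Fin n) × (Fin n → Fin a) // (StrictMono fun x => toLex (p.2 x, p.1 x)) ∧
        ∀ i ∈ Icc 1 n, #{x | minimalPeriod p.1 x = i} = i * lam.parts.count i} ≃
      Σ π : {π : Perm (Fin n) // π ∈ C.carrier},
        {s : Fin n → Fin a // StrictMono fun x => toLex (s x, π.1 x)} :=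
    { toFun p := ⟨⟨p.1.1, (mem_carrier_iff_card_minimalPeriod hC _).2 p.2.2⟩, ⟨p.1.2, p.2.1⟩⟩
      invFun q := ⟨(q.1.1, q.2.1), q.2.2, (mem_carrier_iff_card_minimalPeriod hC _).1 q.1.2⟩ }
  rw [Nat.card_congr e, Nat.card_sigma] at h1
  simp only [card_strictMono_toLex hn] at h1
  rw [← sum_subtype (p := fun π => π ∈ C.carrier) ({π | π ∈ C.carrier} : Finset (Perm (Fin n)))
    (by simp) (fun π => (a + (n - 1 - descentNumber π)).choose n)] at h1
  rw [← Nat.cast_sum, h1, cycleBinomialProduct, Nat.cast_prod]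
  refine prod_congr rfl fun i hi => ?_
  rw [← Ring.choose_natCast_add_sub_one, PeriodicWord.card_orbits a n hi]

/-! ### Polynomiality and reciprocity -/

/-- Functions of an integer given by a rational polynomial. -/
def IsPolynomialFun (f : ℤ → ℚ) : Prop := ∃ P : Polynomial ℚ, ∀ z : ℤ, f z = P.eval (z : ℚ)

namespace IsPolynomialFun

theorem const (c : ℚ) : IsPolynomialFun fun _ => c := ⟨Polynomial.C c, by simp⟩

theorem cast : IsPolynomialFun fun z => (z : ℚ) := ⟨Polynomial.X, by simp⟩

theorem add {f g : ℤ → ℚ} (hf : IsPolynomialFun f) (hg : IsPolynomialFun g) :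
    IsPolynomialFun fun z => f z + g z := by
  obtain ⟨P, hP⟩ := hf
  obtain ⟨Q, hQ⟩ := hg
  exact ⟨P + Q, by simp [hP, hQ]⟩

theorem mul {f g : ℤ → ℚ} (hf : IsPolynomialFun f) (hg : IsPolynomialFun g) :
    IsPolynomialFun fun z => f z * g z := by
  obtain ⟨P, hP⟩ := hf
  obtain ⟨Q, hQ⟩ := hg
  exact ⟨P * Q, by simp [hP, hQ]⟩

theorem pow {f : ℤ → ℚ} (hf : IsPolynomialFun f) (k : ℕ) : IsPolynomialFun fun z => f z ^ k := by
  obtain ⟨P, hP⟩ := hf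
  exact ⟨P ^ k, by simp [hP]⟩

theorem sum {ι : Type*} {s : Finset ι} {f : ι → ℤ → ℚ} (hf : ∀ i ∈ s, IsPolynomialFun (f i)) :
    IsPolynomialFun fun z => ∑ i ∈ s, f i z := by
  choose! P hP using hf
  refine ⟨∑ i ∈ s, P i, fun z => ?_⟩
  rw [Polynomial.eval_finsetSum]
  exact sum_congr rfl fun i hi => hP i hi z

theorem prod {ι : Type*} {s : Finset ι} {f : ι → ℤ → ℚ} (hf : ∀ i ∈ s, IsPolynomialFun (f i)) :
    IsPolynomialFun fun z => ∏ i ∈ s, f i z := by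
  choose! P hP using hf
  refine ⟨∏ i ∈ s, P i, fun z => ?_⟩
  rw [Polynomial.eval_prod]
  exact prod_congr rfl fun i hi => hP i hi z

theorem choose {f : ℤ → ℚ} (hf : IsPolynomialFun f) (k : ℕ) :
    IsPolynomialFun fun z => Ring.choose (f z) k := by
  obtain ⟨P, hP⟩ := hf
  refine ⟨Polynomial.C (k.factorial : ℚ)⁻¹ *
    ((descPochhammer ℤ k).map (Int.castRingHom ℚ)).comp P, fun z => ?_⟩
  simp only
  rw [Ring.choose_eq_smul, hP, ← Polynomial.aeval_eq_smeval, smul_eq_mul, Polynomial.eval_mul,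
    Polynomial.eval_C, Polynomial.eval_comp, Polynomial.eval_map, Polynomial.aeval_def]
  rfl

theorem eq_of_forall_natCast {f g : ℤ → ℚ} (hf : IsPolynomialFun f) (hg : IsPolynomialFun g)
    (h : ∀ a : ℕ, f a = g a) (z : ℤ) : f z = g z := by
  obtain ⟨P, hP⟩ := hf
  obtain ⟨Q, hQ⟩ := hg
  have : P = Q := by
    refine Polynomial.eq_of_infinite_eval_eq P Q ?_
    refine (Set.infinite_range_of_injective (Nat.cast_injective (R := ℚ))).mono ?_
    rintro _ ⟨a, rfl⟩
    have := h a
    rw [hP, hQ] at this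
    simpa using this
  rw [hP, hQ, this]

end IsPolynomialFun

theorem isPolynomialFun_cycleBinomialProduct {n : ℕ} (lam : n.Partition) :
    IsPolynomialFun (cycleBinomialProduct lam) := by
  refine IsPolynomialFun.prod fun i _ => IsPolynomialFun.choose ?_ _
  simp only [sub_eq_add_neg]
  refine ((IsPolynomialFun.mul (.const _) ?_).add (.const _)).add (.const _)
  exact IsPolynomialFun.sum fun d _ => (IsPolynomialFun.const _).mul (IsPolynomialFun.cast.pow _)

open Classical in
/-- Reciprocity: the value of the necklace product at `-a`, in terms of descents. -/
theorem cycleBinomialProduct_neg {n : ℕ} (hn : 1 ≤ n) (lam : n.Partition)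
    (C : ConjClasses (Perm (Fin n))) (hC : ∀ π ∈ C.carrier, π.partition.parts = lam.parts)
    (a : ℕ) :
    (-1) ^ n * cycleBinomialProduct lam (-a) =
      ∑ π : Perm (Fin n) with π ∈ C.carrier, (((a + descentNumber π).choose n : ℕ) : ℚ) := by
  rw [← IsPolynomialFun.eq_of_forall_natCast
    (f := fun z => ∑ π : Perm (Fin n) with π ∈ C.carrier,
      Ring.choose ((z : ℚ) + ((n - 1 - descentNumber π : ℕ) : ℚ)) n)
    (IsPolynomialFun.sum fun π _ => (IsPolynomialFun.cast.add (.const _)).choose n)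
    (isPolynomialFun_cycleBinomialProduct lam) (fun b => ?_) (-a), mul_sum]
  · refine sum_congr rfl fun π _ => ?_
    have hd := descentNumber_lt hn π
    -- Prepares binom(-x, n) = (-1)^n binom(x + n - 1, n) with x = a + d - n + 1, for which x + n -
    -- 1 = a + d.
    have : (((-a : ℤ) : ℚ) + ((n - 1 - descentNumber π : ℕ) : ℚ)) =
        -((a : ℚ) + descentNumber π - n + 1) := by
      rw [Nat.cast_sub (by omega), Nat.cast_sub hn]
      push_cast
      ring
    rw [this, Ring.choose_neg, show (a : ℚ) + descentNumber π - n + 1 + n - 1 =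
      ((a + descentNumber π : ℕ) : ℚ) by push_cast; ring, Ring.choose_natCast, Units.smul_def,
      Int.negOnePow_def]
    simp [← mul_assoc, ← mul_pow]
  · rw [← sum_choose_descentNumber hn lam C hC b]
    refine sum_congr rfl fun π _ => ?_
    rw [← Ring.choose_natCast]
    push_cast
    rfl

/-! ### The generating function -/

theorem hasSum_choose_mul_zpow {n d : ℕ} (hd : d < n) {t : ℂ} (ht : 1 < ‖t‖) :
    HasSum (fun a : ℕ+ => t ^ (-(a : ℤ)) * (((a : ℕ) + d).choose n : ℂ))
      (t ^ (d + 1) / (t - 1) ^ (n + 1)) := by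
  have ht0 : t ≠ 0 := by
    rintro rfl
    norm_num at ht
  have ht1 : t - 1 ≠ 0 := by
    rw [sub_ne_zero]
    rintro rfl
    norm_num at ht
  have hr : ‖t⁻¹‖ < 1 := by
    rw [norm_inv]
    exact inv_lt_one_of_one_lt₀ ht
  obtain ⟨e, rfl⟩ := Nat.exists_eq_add_of_lt hd
  have h1 := (hasSum_choose_mul_geometric_of_norm_lt_one (d + e + 1) hr).mul_left (t⁻¹ ^ (e + 1))
  -- Here j = a - 1 and n = d + e + 1. The first e terms vanish, as a + d < n there; the others form
  -- the binomial series in 1/t scaled by t^{-(e+1)}.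
  let F : ℕ → ℂ := fun j => t⁻¹ ^ (j + 1) * ((j + 1 + d).choose (d + e + 1) : ℂ)
  have h2 : HasSum F (t⁻¹ ^ (e + 1) * (1 / (1 - t⁻¹) ^ (d + e + 1 + 1))) := by
    have h3 := (hasSum_nat_add_iff (f := F) e
      (g := t⁻¹ ^ (e + 1) * (1 / (1 - t⁻¹) ^ (d + e + 1 + 1)))).1 (by
      convert! h1 using 2 with k
      simp only [F]
      rw [show k + e + 1 + d = k + (d + e + 1) by ring]
      ring)
    rwa [sum_eq_zero, add_zero] at h3
    intro i hi
    have := mem_range.1 hi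
    simp only [F]
    rw [Nat.choose_eq_zero_of_lt (by omega)]
    simp
  have hval : t⁻¹ ^ (e + 1) * (1 / (1 - t⁻¹) ^ (d + e + 1 + 1)) =
      t ^ (d + 1) / (t - 1) ^ (d + e + 1 + 1) := by
    rw [show 1 - t⁻¹ = (t - 1) / t by field_simp, div_pow, one_div_div, inv_pow,
      show d + e + 1 + 1 = (e + 1) + (d + 1) by ring, pow_add t]
    field_simp
    ring
  rw [← hval, ← Equiv.pnatEquivNat.symm.hasSum_iff]
  convert! h2 using 1
  funext j
  simp only [F, Function.comp_apply, Equiv.pnatEquivNat_symm_apply, Nat.succPNat_coe, zpow_neg,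
    zpow_natCast, inv_pow, Nat.succ_eq_add_one]

theorem mainTheorem3 (n : ℕ) (hn : 1 ≤ n) (lam : n.Partition)
    (C : ConjClasses (Equiv.Perm (Fin n)))
    (hC : ∀ π ∈ C.carrier, π.partition.parts = lam.parts)
    (t : ℂ) (ht : 1 < ‖t‖) :
    Summable (fun a : ℕ+ =>
      t ^ (-(a : ℤ)) * ((-1 : ℂ) ^ n * (cycleBinomialProduct lam (-(a : ℤ)) : ℂ))) ∧
    descentGenFun C.carrier t =
      (t - 1) ^ (n + 1) * ∑' a : ℕ+,
        t ^ (-(a : ℤ)) * ((-1 : ℂ) ^ n * (cycleBinomialProduct lam (-(a : ℤ)) : ℂ)) := by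
  classical
  have ht1 : t - 1 ≠ 0 := by
    rw [sub_ne_zero]
    rintro rfl
    norm_num at ht
  have h := hasSum_sum (s := ({π | π ∈ C.carrier} : Finset (Perm (Fin n)))) fun π _ =>
    hasSum_choose_mul_zpow (descentNumber_lt hn π) ht
  have hterm : (fun a : ℕ+ =>
      t ^ (-(a : ℤ)) * ((-1 : ℂ) ^ n * (cycleBinomialProduct lam (-(a : ℤ)) : ℂ))) =
      fun a : ℕ+ => ∑ π : Perm (Fin n) with π ∈ C.carrier,
        t ^ (-(a : ℤ)) * (((a : ℕ) + descentNumber π).choose n : ℂ) := by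
    ext a
    rw [← mul_sum]
    congr 1
    exact_mod_cast congrArg (fun q : ℚ => (q : ℂ)) (cycleBinomialProduct_neg hn lam C hC a)
  rw [hterm]
  refine ⟨h.summable, ?_⟩
  rw [h.tsum_eq, mul_sum, descentGenFun]
  refine sum_congr (by congr!) fun π _ => ?_
  rw [mul_div_cancel₀ _ (pow_ne_zero _ ht1)]
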